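/- A preordered set $(\Lambda,\lesssim)$ is called $\mathbb{Z}$-like if every finite subset of $\Lambda$ is contained in a finite subset $S$ that is strongly convex: every $i\in\Lambda\setminus S$ lies strictly below all elements of $S$ or strictly above all elements of $S$. (Here $i$ is strictly below $j$ if $i\lesssim j$ and $j\not\lesssim i$.) A subset $S$ is convex if $i,j\in S$ and $i\lesssim k\lesssim j$ imply $k\in S$. Let $\Lambda$ be an infinite $\mathbb{Z}$-like preordered set and $F$ a field, regarded as a discrete topological field. Let $\mathrm{AU}_\Lambda(F)$ be the group, under matrix multiplication, of all $\Lambda\times\Lambda$-matrices $(a_{ij})$ over $F$ that are * almost upper triangular: $a_{ij}=0$ for all but finitely many pairs $(i,j)$ with $i\not\lesssim j$; and * nonsingular: there is a finite convex $S\subset\Lambda$ such that $(a_{ij})_{i,j\in T}$ is invertible for every finite convex $T\supseteq S$. For finite convex $S\subset\Lambda$ let $\mathrm{U}_{\Lambda+S}(F)$ be the set of those elements of $\mathrm{AU}_\Lambda(F)$ that are upper triangular for the preorder generated by $\lesssim$ and $S\times S$, with the topology of entrywise convergence. Then $\mathrm{AU}_\Lambda(F)=\bigcup_S\mathrm{U}_{\Lambda+S}(F)$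 carries the direct limit topology, i.e. a subset is open if and only if its intersection with each $\mathrm{U}_{\Lambda+S}(F)$ is open in $\mathrm{U}_{\Lambda+S}(F)$. Let $\mathrm{Z}_\Lambda(F)$ be the normal subgroup of nonsingular scalar matrices. Put $$\mathrm{L}(F)=\{(x_j)\in F^\Lambda \mid \text{there is } k\in\Lambda \text{ with } x_l=0 \text{ for all } l \text{ with } k\lesssim l\}$$ and $$\mathcal{AU}_\Lambda(F)=\Bigl\{I+B\in\mathrm{AU}_\Lambda(F) \Bigm| \text{the map } (x_j)\mapsto \bigl(\textstyle\sum_{j} b_{ij}x_j\bigr)_i \text{ on } \mathrm{L}(F) \text{ has finite rank}\Bigr\},$$ where finite rank means that the image of $\mathrm{L}(F)$ spans a finite-dimensional subspace of $F^\Lambda$. Then $\mathcal{AU}_\Lambda(F)$ is a subgroup of $\mathrm{AU}_\Lambda(F)$; it is proper, dense and normal. In particular, $\mathrm{AU}_\Lambda(F)/\mathrm{Z}_\Lambda(F)$ is a nontrivial group that is not simple as an abstract group. -/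

import Mathlib

namespace AlmostUpperTriangular

section Preorders

variable {Λ : Type*} [Preorder Λ]

/-- `S` is strongly convex: every element outside `S` lies strictly below all of `S` or strictly
above all of `S` (in a preorder, `i < j` means `i ≤ j` and not `j ≤ i`). -/
def StronglyConvex (S : Set Λ) : Prop :=
  ∀ i, i ∉ S → (∀ j ∈ S, i < j) ∨ (∀ j ∈ S, j < i)

/-- A preordered set is `ℤ`-like if every finite subset is contained in a finite strongly convex
subset. -/
class ZLike (Λ : Type*) [Preorder Λ] : Prop where
  exists_finite_stronglyConvex :
    ∀ A : Finset Λ, ∃ S : Finset Λ, A ⊆ S ∧ StronglyConvex (S : Set Λ)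

/-- The preorder of `Λ + S`: the one generated by `≤` together with declaring all elements of `S`
equivalent. -/
def JoinLE (S : Finset Λ) : Λ → Λ → Prop :=
  Relation.ReflTransGen fun i j => i ≤ j ∨ (i ∈ S ∧ j ∈ S)

end Preorders

section Matrices

open scoped Classical

variable {Λ : Type*} {F : Type*} [Field F]

/-- The finite submatrix of `a` with rows and columns in `T`. -/
def res (T : Finset Λ) (a : Matrix Λ Λ F) : Matrix T T F :=
  a.submatrix Subtype.val Subtype.val

/-- The product of infinite matrices (the sums are finite for almost upper triangular matrices). -/
noncomputable def mulMat (a b : Matrix Λ Λ F) : Matrix Λ Λ F :=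
  fun i j => ∑ᶠ k, a i k * b k j

/-- The column vector `a x` (the sums are finite where it is used). -/
noncomputable def act (a : Matrix Λ Λ F) (x : Λ → F) : Λ → F :=
  fun i => ∑ᶠ j, a i j * x j

/-- `a` is a scalar matrix. -/
def IsScalar (a : Matrix Λ Λ F) : Prop :=
  (∀ i j, i ≠ j → a i j = 0) ∧ ∀ i j, a i i = a j j

theorem res_one (T : Finset Λ) : res T (1 : Matrix Λ Λ F) = 1 :=
  Matrix.submatrix_one _ Subtype.val_injective

theorem mulMat_one (a : Matrix Λ Λ F) : mulMat a 1 = a := by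
  ext i j
  change ∑ᶠ k, a i k * (1 : Matrix Λ Λ F) k j = a i j
  rw [finsum_eq_single _ j fun k hk => by rw [Matrix.one_apply_ne hk, mul_zero]]
  simp

theorem one_mulMat (a : Matrix Λ Λ F) : mulMat 1 a = a := by
  ext i j
  change ∑ᶠ k, (1 : Matrix Λ Λ F) i k * a k j = a i j
  rw [finsum_eq_single _ i fun k hk => by rw [Matrix.one_apply_ne hk.symm, zero_mul]]
  simp

theorem IsScalar.mulMat_apply {a : Matrix Λ Λ F} (ha : IsScalar a) (b : Matrix Λ Λ F) (i j : Λ) :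
    mulMat a b i j = a i i * b i j :=
  finsum_eq_single _ i fun k hk => by rw [ha.1 i k hk.symm, zero_mul]

theorem IsScalar.mulMat_apply_right {a : Matrix Λ Λ F} (ha : IsScalar a) (b : Matrix Λ Λ F)
    (i j : Λ) : mulMat b a i j = b i j * a j j :=
  finsum_eq_single _ j fun k hk => by rw [ha.1 k j hk, mul_zero]

variable [Preorder Λ]

/-- `a` has only finitely many nonzero entries at positions `(i, j)` with `¬ i ≤ j`. -/
def AlmostUpper (a : Matrix Λ Λ F) : Prop :=
  {p : Λ × Λ | ¬ p.1 ≤ p.2 ∧ a p.1 p.2 ≠ 0}.Finite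

/-- `a` is nonsingular: for some finite convex `S`, the `T × T`-submatrix of `a` is invertible for
every finite convex `T ⊇ S`. -/
def Nonsingular (a : Matrix Λ Λ F) : Prop :=
  ∃ S : Finset Λ, (S : Set Λ).OrdConnected ∧
    ∀ T : Finset Λ, (T : Set Λ).OrdConnected → S ⊆ T → IsUnit (res T a)

variable (Λ F) in
/-- The underlying set of `AU_Λ(F)`: nonsingular almost upper triangular matrices. -/
@[ext] structure AU where
  toMatrix : Matrix Λ Λ F
  almostUpper : AlmostUpper toMatrix
  nonsingular : Nonsingular toMatrix

/-! ### `AU_Λ(F)` is a group -/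

/-- `a` vanishes at `(i, j)` unless `i ≤ j` or both `i` and `j` lie in `S`. -/
def Adapted (S : Finset Λ) (a : Matrix Λ Λ F) : Prop :=
  ∀ i j, a i j ≠ 0 → i ≤ j ∨ (i ∈ S ∧ j ∈ S)

theorem StronglyConvex.ordConnected {S : Set Λ} (h : StronglyConvex S) : S.OrdConnected := by
  refine ⟨fun i hi j hj k hk => ?_⟩
  by_contra hkS
  rcases h k hkS with h1 | h1
  · exact (h1 i hi).not_ge hk.1
  · exact (h1 j hj).not_ge hk.2

theorem Adapted.mono {S T : Finset Λ} {a : Matrix Λ Λ F} (h : Adapted S a) (hST : S ⊆ T) :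
    Adapted T a := fun i j hij => (h i j hij).imp id fun h => ⟨hST h.1, hST h.2⟩

theorem Adapted.almostUpper {S : Finset Λ} {a : Matrix Λ Λ F} (h : Adapted S a) :
    AlmostUpper a := by
  refine (S ×ˢ S).finite_toSet.subset ?_
  rintro ⟨i, j⟩ ⟨h1, h2⟩
  have := (h i j h2).resolve_left h1
  simpa using this

theorem AlmostUpper.exists_finset {a : Matrix Λ Λ F} (h : AlmostUpper a) :
    ∃ A : Finset Λ, Adapted A a := by
  refine ⟨h.toFinset.image Prod.fst ∪ h.toFinset.image Prod.snd, fun i j hij => ?_⟩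
  by_cases hle : i ≤ j
  · exact Or.inl hle
  · have hm : (i, j) ∈ h.toFinset := h.mem_toFinset.2 ⟨hle, hij⟩
    exact Or.inr ⟨Finset.mem_union_left _ (Finset.mem_image_of_mem Prod.fst hm),
      Finset.mem_union_right _ (Finset.mem_image_of_mem Prod.snd hm)⟩

/-- Transitivity of the relation `i ≤ j ∨ i, j ∈ S` for strongly convex `S`. -/
theorem StronglyConvex.trans {S : Finset Λ} (hS : StronglyConvex (S : Set Λ)) {i k j : Λ}
    (h1 : i ≤ k ∨ (i ∈ S ∧ k ∈ S)) (h2 : k ≤ j ∨ (k ∈ S ∧ j ∈ S)) :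
    i ≤ j ∨ (i ∈ S ∧ j ∈ S) := by
  rcases h1 with h1 | ⟨hi, hk⟩ <;> rcases h2 with h2 | ⟨hk', hj⟩
  · exact Or.inl (h1.trans h2)
  · by_cases hi : i ∈ S
    · exact Or.inr ⟨hi, hj⟩
    · rcases hS i hi with h | h
      · exact Or.inl (h j hj).le
      · exact absurd h1 (h k hk').not_ge
  · by_cases hj : j ∈ S
    · exact Or.inr ⟨hi, hj⟩
    · rcases hS j hj with h | h
      · exact absurd h2 (h k hk).not_ge
      · exact Or.inl (h i hi).le
  · exact Or.inr ⟨hi, hj⟩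

theorem mem_of_between {S T : Finset Λ} (hT : (T : Set Λ).OrdConnected) (hST : S ⊆ T)
    {i k j : Λ} (hi : i ∈ T) (hj : j ∈ T)
    (h1 : i ≤ k ∨ (i ∈ S ∧ k ∈ S)) (h2 : k ≤ j ∨ (k ∈ S ∧ j ∈ S)) : k ∈ T := by
  rcases h1 with h1 | ⟨_, hk⟩
  · rcases h2 with h2 | ⟨hk, _⟩
    · exact hT.out hi hj ⟨h1, h2⟩
    · exact hST hk
  · exact hST hk

theorem mulMat_apply_eq {S T : Finset Λ} {a b : Matrix Λ Λ F} (ha : Adapted S a)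
    (hb : Adapted S b) (hT : (T : Set Λ).OrdConnected) (hST : S ⊆ T) {i j : Λ}
    (hi : i ∈ T) (hj : j ∈ T) : mulMat a b i j = ∑ k ∈ T, a i k * b k j := by
  refine finsum_eq_sum_of_support_subset _ fun k hk => ?_
  have hk' : a i k * b k j ≠ 0 := hk
  exact mem_of_between hT hST hi hj (ha i k (left_ne_zero_of_mul hk'))
    (hb k j (right_ne_zero_of_mul hk'))

theorem res_mulMat {S T : Finset Λ} {a b : Matrix Λ Λ F} (ha : Adapted S a)
    (hb : Adapted S b) (hT : (T : Set Λ).OrdConnected) (hST : S ⊆ T) :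
    res T (mulMat a b) = res T a * res T b := by
  ext i j
  rw [Matrix.mul_apply]
  change mulMat a b i j = ∑ k : T, a i k * b k j
  rw [mulMat_apply_eq ha hb hT hST i.2 j.2, ← Finset.sum_coe_sort]

theorem Adapted.mul {S : Finset Λ} {a b : Matrix Λ Λ F} (hS : StronglyConvex (S : Set Λ))
    (ha : Adapted S a) (hb : Adapted S b) : Adapted S (mulMat a b) := by
  intro i j hij
  obtain ⟨k, hk⟩ : ∃ k, a i k * b k j ≠ 0 := by
    by_contra! h
    exact hij (finsum_eq_zero_of_forall_eq_zero h)
  exact hS.trans (ha i k (left_ne_zero_of_mul hk)) (hb k j (right_ne_zero_of_mul hk))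

theorem adapted_one (S : Finset Λ) : Adapted S (1 : Matrix Λ Λ F) := by
  intro i j hij
  by_cases h : i = j
  · exact Or.inl h.le
  · exact absurd (Matrix.one_apply_ne h) hij

theorem nonsingular_one : Nonsingular (1 : Matrix Λ Λ F) :=
  ⟨∅, by simpa using Set.ordConnected_empty, fun T _ _ => by rw [res_one]; exact isUnit_one⟩

/-- If an invertible finite matrix vanishes outside the relation `i ≤ j ∨ i, j ∈ S`, so does its
inverse. -/
theorem inv_adapted {S T : Finset Λ} (hS : StronglyConvex (S : Set Λ)) {M : Matrix T T F}
    (hM : IsUnit M)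
    (hMS : ∀ i j : T, M i j ≠ 0 → i.1 ≤ j.1 ∨ (i.1 ∈ S ∧ j.1 ∈ S)) (i j : T)
    (hij : M⁻¹ i j ≠ 0) : i.1 ≤ j.1 ∨ (i.1 ∈ S ∧ j.1 ∈ S) := by
  let A : Submodule F (Matrix T T F) :=
    { carrier := {N | ∀ i j : T, ¬ (i.1 ≤ j.1 ∨ (i.1 ∈ S ∧ j.1 ∈ S)) → N i j = 0}
      add_mem' := fun {x y} hx hy i j h => by simp [hx i j h, hy i j h]
      zero_mem' := fun i j _ => rfl
      smul_mem' := fun c x hx i j h => by simp [hx i j h] }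
  have hmul : ∀ N ∈ A, M * N ∈ A := by
    intro N hN i j h
    rw [Matrix.mul_apply]
    refine Finset.sum_eq_zero fun k _ => ?_
    by_contra hk
    refine h (hS.trans (hMS i k (left_ne_zero_of_mul hk)) ?_)
    by_contra h'
    exact right_ne_zero_of_mul hk (hN k j h')
  let L : A →ₗ[F] A := (LinearMap.mulLeft F M).restrict hmul
  have hinj : Function.Injective L := by
    intro x y hxy
    have h : M * x.1 = M * y.1 := congrArg Subtype.val hxy
    exact Subtype.ext (hM.mul_left_cancel h)
  have h1 : (1 : Matrix T T F) ∈ A := fun i j h =>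
    Matrix.one_apply_ne fun hij => h (Or.inl (by rw [hij]))
  obtain ⟨N, hN⟩ := LinearMap.injective_iff_surjective.1 hinj ⟨1, h1⟩
  have hMN : M * N.1 = 1 := congrArg Subtype.val hN
  by_contra h
  rw [Matrix.inv_eq_right_inv hMN] at hij
  exact hij (N.2 i j h)

/-- Inverses of finite submatrices are compatible with restriction. -/
theorem exists_local_inv {S T : Finset Λ} {a : Matrix Λ Λ F} (hS : StronglyConvex (S : Set Λ))
    (ha : Adapted S a) (hT : (T : Set Λ).OrdConnected) (hST : S ⊆ T) (hu : IsUnit (res T a)) :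
    ∃ e : Matrix Λ Λ F, Adapted S e ∧ ∀ U : Finset Λ, (U : Set Λ).OrdConnected → S ⊆ U → U ⊆ T →
      res U a * res U e = 1 := by
  let e : Matrix Λ Λ F := fun i j =>
    if h : i ∈ T ∧ j ∈ T then (res T a)⁻¹ ⟨i, h.1⟩ ⟨j, h.2⟩ else 0
  have heT : res T e = (res T a)⁻¹ := by
    ext i j
    exact dif_pos ⟨i.2, j.2⟩
  have he : Adapted S e := by
    intro i j hij
    by_cases h : i ∈ T ∧ j ∈ T
    · have h0 : e i j = (res T a)⁻¹ ⟨i, h.1⟩ ⟨j, h.2⟩ := dif_pos h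
      rw [h0] at hij
      exact inv_adapted hS hu (fun i j h => ha i j h) _ _ hij
    · exact absurd (dif_neg h) hij
  refine ⟨e, he, fun U hU hSU hUT => ?_⟩
  have h1 : res T (mulMat a e) = 1 := by
    rw [res_mulMat ha he hT hST, heT]
    exact Matrix.mul_nonsing_inv _ ((Matrix.isUnit_iff_isUnit_det _).1 hu)
  rw [← res_mulMat ha he hU hSU, ← res_one (F := F) U]
  ext i j
  have h2 := congrFun (congrFun (h1.trans (res_one (F := F) T).symm) ⟨i, hUT i.2⟩) ⟨j, hUT j.2⟩
  exact h2

namespace AU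

noncomputable instance : One (AU Λ F) :=
  ⟨⟨1, (adapted_one ∅).almostUpper, nonsingular_one⟩⟩

theorem toMatrix_one : (1 : AU Λ F).toMatrix = 1 := rfl

end AU

variable [ZLike Λ]

theorem exists_adapted (A : Finset Λ) {a : Matrix Λ Λ F} (ha : AlmostUpper a) :
    ∃ S : Finset Λ, A ⊆ S ∧ StronglyConvex (S : Set Λ) ∧ Adapted S a := by
  obtain ⟨B, hB⟩ := ha.exists_finset
  obtain ⟨S, h1, h2⟩ := ZLike.exists_finite_stronglyConvex (A ∪ B)
  exact ⟨S, Finset.union_subset_left h1, h2, hB.mono (Finset.union_subset_right h1)⟩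

theorem exists_adapted₂ (A : Finset Λ) {a b : Matrix Λ Λ F} (ha : AlmostUpper a)
    (hb : AlmostUpper b) :
    ∃ S : Finset Λ, A ⊆ S ∧ StronglyConvex (S : Set Λ) ∧ Adapted S a ∧ Adapted S b := by
  obtain ⟨B, hB⟩ := ha.exists_finset
  obtain ⟨S, h1, h2, h3⟩ := exists_adapted (A ∪ B) hb
  exact ⟨S, Finset.union_subset_left h1, h2, hB.mono (Finset.union_subset_right h1), h3⟩

theorem AlmostUpper.mul {a b : Matrix Λ Λ F} (ha : AlmostUpper a) (hb : AlmostUpper b) :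
    AlmostUpper (mulMat a b) := by
  obtain ⟨S, -, hS, h1, h2⟩ := exists_adapted₂ ∅ ha hb
  exact (h1.mul hS h2).almostUpper

theorem Nonsingular.mul {a b : Matrix Λ Λ F} (ha : AlmostUpper a) (hb : AlmostUpper b)
    (ha' : Nonsingular a) (hb' : Nonsingular b) : Nonsingular (mulMat a b) := by
  obtain ⟨A, -, hA⟩ := ha'
  obtain ⟨B, -, hB⟩ := hb'
  obtain ⟨S, hS0, hS, h1, h2⟩ := exists_adapted₂ (A ∪ B) ha hb
  refine ⟨S, hS.ordConnected, fun T hT hST => ?_⟩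
  rw [res_mulMat h1 h2 hT hST]
  exact (hA T hT ((Finset.union_subset_left hS0).trans hST)).mul
    (hB T hT ((Finset.union_subset_right hS0).trans hST))

theorem mulMat_assoc {a b c : Matrix Λ Λ F} (ha : AlmostUpper a) (hb : AlmostUpper b)
    (hc : AlmostUpper c) : mulMat (mulMat a b) c = mulMat a (mulMat b c) := by
  ext i j
  obtain ⟨A, hA⟩ := ha.exists_finset
  obtain ⟨S, hS0, hS, h2, h3⟩ := exists_adapted₂ ({i, j} ∪ A) hb hc
  have h1 := hA.mono (Finset.union_subset_right hS0)
  have hi : i ∈ S := hS0 (by simp)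
  have hj : j ∈ S := hS0 (by simp)
  have hres : res S (mulMat (mulMat a b) c) = res S (mulMat a (mulMat b c)) := by
    rw [res_mulMat (h1.mul hS h2) h3 hS.ordConnected le_rfl,
      res_mulMat h1 (h2.mul hS h3) hS.ordConnected le_rfl,
      res_mulMat h1 h2 hS.ordConnected le_rfl, res_mulMat h2 h3 hS.ordConnected le_rfl,
      mul_assoc]
  exact congrFun (congrFun hres ⟨i, hi⟩) ⟨j, hj⟩

/-- A nonsingular almost upper triangular matrix has an inverse of the same kind. -/
theorem exists_inverse {a : Matrix Λ Λ F} (ha : AlmostUpper a) (ha' : Nonsingular a) :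
    ∃ b : Matrix Λ Λ F, AlmostUpper b ∧ Nonsingular b ∧ mulMat b a = 1 := by
  obtain ⟨S₀, -, hu₀⟩ := ha'
  obtain ⟨S, hS₀, hS, haS⟩ := exists_adapted S₀ ha
  have hu : ∀ T : Finset Λ, (T : Set Λ).OrdConnected → S ⊆ T → IsUnit (res T a) :=
    fun T hT h => hu₀ T hT (hS₀.trans h)
  have hE : ∀ T : Finset Λ, (T : Set Λ).OrdConnected → S ⊆ T →
      ∃ e : Matrix Λ Λ F, Adapted S e ∧
        ∀ U : Finset Λ, (U : Set Λ).OrdConnected → S ⊆ U → U ⊆ T → res U a * res U e = 1 :=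
    fun T hT h => exists_local_inv hS haS hT h (hu T hT h)
  choose! e heS he using hE
  have hT : ∀ i j : Λ, ∃ T : Finset Λ, S ∪ {i, j} ⊆ T ∧ StronglyConvex (T : Set Λ) :=
    fun i j => ZLike.exists_finite_stronglyConvex _
  choose T hT₁ hT₂ using hT
  have hST : ∀ i j, S ⊆ T i j := fun i j => Finset.union_subset_left (hT₁ i j)
  have hiT : ∀ i j, i ∈ T i j := fun i j => hT₁ i j (by simp)
  have hjT : ∀ i j, j ∈ T i j := fun i j => hT₁ i j (by simp)
  let b : Matrix Λ Λ F := fun i j => e (T i j) i j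
  have hb : Adapted S b := fun i j hij => heS _ (hT₂ i j).ordConnected (hST i j) i j hij
  have hbU : ∀ U : Finset Λ, (U : Set Λ).OrdConnected → S ⊆ U → res U b * res U a = 1 := by
    intro U hU hSU
    have key : res U b = (res U a)⁻¹ := by
      ext i j
      obtain ⟨V, hV₁, hV₂⟩ := ZLike.exists_finite_stronglyConvex (U ∪ T i j)
      have hUV := Finset.union_subset_left hV₁
      have hTV := Finset.union_subset_right hV₁
      have hSV := hSU.trans hUV
      have e1 := Matrix.inv_eq_right_inv
        (he V hV₂.ordConnected hSV U hU hSU hUV)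
      have e2 := Matrix.inv_eq_right_inv
        (he V hV₂.ordConnected hSV (T i j) (hT₂ i j).ordConnected (hST i j) hTV)
      have e3 := Matrix.inv_eq_right_inv
        (he (T i j) (hT₂ i j).ordConnected (hST i j) (T i j) (hT₂ i j).ordConnected (hST i j)
          le_rfl)
      rw [e1]
      exact congrFun (congrFun (e3.symm.trans e2) ⟨i, hiT i j⟩) ⟨j, hjT i j⟩
    rw [key]
    exact Matrix.nonsing_inv_mul _ ((Matrix.isUnit_iff_isUnit_det _).1 (hu U hU hSU))
  refine ⟨b, hb.almostUpper, ⟨S, hS.ordConnected, fun U hU hSU => ?_⟩, ?_⟩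
  · exact IsUnit.of_mul_eq_one _ (hbU U hU hSU)
  · ext i j
    have h1 : res (T i j) (mulMat b a) = res (T i j) 1 := by
      rw [res_mulMat hb haS (hT₂ i j).ordConnected (hST i j),
        hbU _ (hT₂ i j).ordConnected (hST i j), res_one]
    exact congrFun (congrFun h1 ⟨i, hiT i j⟩) ⟨j, hjT i j⟩

namespace AU

noncomputable instance : Mul (AU Λ F) :=
  ⟨fun a b => ⟨mulMat a.toMatrix b.toMatrix, a.almostUpper.mul b.almostUpper,
    a.nonsingular.mul a.almostUpper b.almostUpper b.nonsingular⟩⟩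

noncomputable instance : Inv (AU Λ F) :=
  ⟨fun a =>
    ⟨(exists_inverse a.almostUpper a.nonsingular).choose,
      (exists_inverse a.almostUpper a.nonsingular).choose_spec.1,
      (exists_inverse a.almostUpper a.nonsingular).choose_spec.2.1⟩⟩

theorem toMatrix_mul (a b : AU Λ F) : (a * b).toMatrix = mulMat a.toMatrix b.toMatrix := rfl

/-- `AU_Λ(F)` is a group under matrix multiplication. -/
noncomputable instance : Group (AU Λ F) :=
  Group.ofLeftAxioms
    (fun a b c => AU.ext (mulMat_assoc a.almostUpper b.almostUpper c.almostUpper))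
    (fun a => AU.ext (one_mulMat a.toMatrix))
    (fun a => AU.ext (exists_inverse a.almostUpper a.nonsingular).choose_spec.2.2)

end AU

theorem IsScalar.commute {z : AU Λ F} (hz : IsScalar z.toMatrix) (g : AU Λ F) :
    z * g = g * z := by
  refine AU.ext ?_
  ext i j
  rw [AU.toMatrix_mul, AU.toMatrix_mul, hz.mulMat_apply, hz.mulMat_apply_right, hz.2 i j, mul_comm]

variable (Λ F) in
/-- `Z_Λ(F)`: the subgroup of nonsingular scalar matrices. -/
noncomputable def scalarSubgroup : Subgroup (AU Λ F) where
  carrier := {z | IsScalar z.toMatrix}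
  one_mem' := ⟨fun i j h => Matrix.one_apply_ne h, fun i j => by
    rw [AU.toMatrix_one, Matrix.one_apply_eq, Matrix.one_apply_eq]⟩
  mul_mem' := fun {x y} hx hy => by
    refine ⟨fun i j h => ?_, fun i j => ?_⟩
    · rw [AU.toMatrix_mul, IsScalar.mulMat_apply hx, hy.1 i j h, mul_zero]
    · rw [AU.toMatrix_mul, IsScalar.mulMat_apply hx, IsScalar.mulMat_apply hx, hx.2 i j, hy.2 i j]
  inv_mem' := fun {x} hx => by
    have h : ∀ i j, x.toMatrix i i * (x⁻¹).toMatrix i j = (1 : Matrix Λ Λ F) i j := fun i j => by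
      rw [← IsScalar.mulMat_apply hx, ← AU.toMatrix_mul, mul_inv_cancel, AU.toMatrix_one]
    have h0 : ∀ i, x.toMatrix i i ≠ 0 := fun i h' => by
      have := h i i
      rw [h', zero_mul, Matrix.one_apply_eq] at this
      exact zero_ne_one this
    refine ⟨fun i j hij => ?_, fun i j => ?_⟩
    · have := h i j
      rw [Matrix.one_apply_ne hij] at this
      exact (mul_eq_zero.1 this).resolve_left (h0 i)
    · refine mul_left_cancel₀ (h0 i) ?_
      rw [h i i, hx.2 i j, h j j, Matrix.one_apply_eq, Matrix.one_apply_eq]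

instance : (scalarSubgroup Λ F).Normal :=
  ⟨fun z hz g => by
    rw [← IsScalar.commute hz g, mul_assoc, mul_inv_cancel, mul_one]
    exact hz⟩

/-! ### The topology of `AU_Λ(F)` -/

variable (Λ F) in
/-- `U_{Λ+S}(F)`: the elements of `AU_Λ(F)` that are upper triangular for the preorder of
`Λ + S`. -/
def UJoin (S : Finset Λ) : Set (AU Λ F) :=
  {a | ∀ i j, ¬ JoinLE S i j → a.toMatrix i j = 0}

variable (Λ F) in
/-- The topology of entrywise convergence on `U_{Λ+S}(F)`, the field `F` being discrete. -/
abbrev entrywiseTopology (S : Finset Λ) : TopologicalSpace (UJoin Λ F S) :=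
  TopologicalSpace.induced (fun a (p : Λ × Λ) => a.1.toMatrix p.1 p.2)
    (@Pi.topologicalSpace (Λ × Λ) (fun _ => F) fun _ => ⊥)

/-- The direct limit topology on `AU_Λ(F) = ⋃ U_{Λ+S}(F)`, over all finite convex `S`: a subset of
`AU_Λ(F)` is open exactly when its trace on every `U_{Λ+S}(F)` is open for entrywise convergence.
As `U_{Λ+S}(F) ∩ U_{Λ+S'}(F)` is open in both and has the same topology from either, this is the
topology for which all inclusions `U_{Λ+S}(F) → AU_Λ(F)` are open embeddings. -/
instance : TopologicalSpace (AU Λ F) :=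
  ⨆ S : {S : Finset Λ // (S : Set Λ).OrdConnected},
    TopologicalSpace.coinduced Subtype.val (entrywiseTopology Λ F S.1)

/-! ### The subgroup of finite-rank perturbations of the identity -/

variable (Λ F) in
/-- `L(F)`: the vectors `x` for which there is `k` with `x l = 0` for all `l ≥ k`. -/
def vecL : Set (Λ → F) :=
  {x | ∃ k : Λ, ∀ l, k ≤ l → x l = 0}

/-- The map `x ↦ b x` on `L(F)` has finite rank: its image spans a finite-dimensional subspace. -/
def HasFiniteRank (b : Matrix Λ Λ F) : Prop :=
  FiniteDimensional F (Submodule.span F (act b '' vecL Λ F))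

variable (Λ F) in
/-- The set of all `1 + b` in `AU_Λ(F)` such that `b` acts with finite rank on `L(F)`. -/
def finiteRankAU : Set (AU Λ F) :=
  {g | ∃ b : Matrix Λ Λ F, g.toMatrix = 1 + b ∧ HasFiniteRank b}

end Matrices
end AlmostUpperTriangular

/-! Finite rank on `L(F)` amounts to finite row rank of the matrix (`hasFiniteRank_iff`): row rank
is finite exactly when `b = c m` factors through a finite index set, a condition symmetric under
transposition, and `L(F)` sees all but finitely many columns. Since products of almost upper
triangular matrices involve only finite sums, such factorizations survive multiplication on either
side. The finite-rank matrices thus behave like a two-sided ideal, and the identities gh - 1 = g(h -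
1) + (g - 1), g⁻¹ - 1 = -g⁻¹(g - 1) and gng⁻¹ - 1 = g(n - 1)g⁻¹ yield a normal subgroup N.

N is dense because a neighbourhood of g within one `UJoin Λ F S` constrains only finitely many
entries: g can be kept on a large finite block and replaced by the identity elsewhere.

N is not everything, even modulo scalars: some g has an infinite identity minor off the diagonal,
whereas off the diagonal an element of N times a scalar matrix agrees with a matrix of finite rank
(`exists_ne_finiteRank_mul_scalar`). As N also contains a nonscalar element, its image in the
quotient by the scalars is a proper nontrivial normal subgroup. -/

namespace AlmostUpperTriangular

/-! ### Infinite matrices of finite row rank -/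

section FiniteRank

open scoped Classical

variable {Λ F : Type*} [Field F]

/-- The rows of `b` span a finite-dimensional space. -/
def FiniteRank (b : Matrix Λ Λ F) : Prop :=
  FiniteDimensional F (Submodule.span F (Set.range fun i j => b i j))

theorem finiteRank_of_factor {b c m : Matrix Λ Λ F} {I : Finset Λ}
    (h : ∀ i j, b i j = ∑ k ∈ I, c i k * m k j) : FiniteRank b := by
  have : FiniteDimensional F (Submodule.span F ((fun k j => m k j) '' (I : Set Λ))) :=
    FiniteDimensional.span_of_finite F (I.finite_toSet.image _)
  refine Submodule.finiteDimensional_of_le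
    (S₂ := Submodule.span F ((fun k j => m k j) '' (I : Set Λ))) (Submodule.span_le.2 ?_)
  rintro _ ⟨i, rfl⟩
  have hi : (fun j => b i j) = ∑ k ∈ I, c i k • fun j => m k j := by
    ext j
    simp [h i j]
  change (fun j => b i j) ∈ _
  rw [hi]
  exact Submodule.sum_mem _ fun k hk =>
    Submodule.smul_mem _ _ (Submodule.subset_span ⟨k, hk, rfl⟩)

/-- Finitely many of the rows already span the row space; `c` records the coefficients. -/
theorem FiniteRank.exists_factor {b : Matrix Λ Λ F} (h : FiniteRank b) :
    ∃ (I : Finset Λ) (c : Matrix Λ Λ F), ∀ i j, b i j = ∑ k ∈ I, c i k * b k j := by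
  have hfg : (Submodule.span F (Set.range fun i j => b i j)).FG :=
    Module.Finite.iff_fg.1 h
  obtain ⟨s, hs, hspan⟩ := (Submodule.fg_span_iff_fg_span_finset_subset _).1 hfg
  rw [← Set.image_univ] at hs
  obtain ⟨I, -, rfl⟩ := Finset.subset_set_image_iff.1 hs
  have hc : ∀ i, ∃ c : Λ → F, ∑ k ∈ I, c k • (fun j => b k j) = fun j => b i j := fun i => by
    have hi : (fun j => b i j) ∈ Submodule.span F (Set.range fun i j => b i j) :=
      Submodule.subset_span ⟨i, rfl⟩
    rw [hspan, Finset.coe_image] at hi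
    obtain ⟨c, hc⟩ := Submodule.mem_span_image_finset_iff_exists_fun F |>.1 hi
    -- The value 0 off `I` is never read.
    refine ⟨fun k => if hk : k ∈ I then c ⟨k, hk⟩ else 0, ?_⟩
    rw [← hc, ← Finset.sum_coe_sort]
    exact Finset.sum_congr rfl fun k _ => by simp
  choose c hc using hc
  refine ⟨I, c, fun i j => ?_⟩
  rw [← congrFun (hc i) j]
  simp

/-- Row rank against column rank: transposing b = c m gives a factorization through the same finite
index set. -/
theorem FiniteRank.transpose {b : Matrix Λ Λ F} (h : FiniteRank b) : FiniteRank b.transpose := by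
  obtain ⟨I, c, hc⟩ := h.exists_factor
  refine finiteRank_of_factor (c := b.transpose) (m := c.transpose) (I := I) fun i j => ?_
  rw [Matrix.transpose_apply, hc]
  exact Finset.sum_congr rfl fun k _ => mul_comm _ _

theorem finiteRank_zero : FiniteRank (0 : Matrix Λ Λ F) :=
  finiteRank_of_factor (c := 0) (m := 0) (I := ∅) fun i j => by simp

theorem finiteRank_of_row_support {b : Matrix Λ Λ F} {T : Finset Λ}
    (h : ∀ i j, b i j ≠ 0 → i ∈ T) : FiniteRank b := by
  -- Projecting onto the rows in `T` leaves `b` unchanged.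
  refine finiteRank_of_factor (c := 1) (m := b) (I := T) fun i j => ?_
  by_cases hi : i ∈ T
  · simp [Matrix.one_apply, hi]
  · simp [Matrix.one_apply, hi, not_imp_comm.1 (h i j) hi]

theorem FiniteRank.smul {b : Matrix Λ Λ F} (h : FiniteRank b) (r : F) : FiniteRank (r • b) := by
  obtain ⟨I, c, hc⟩ := h.exists_factor
  refine finiteRank_of_factor (c := r • c) (m := b) (I := I) fun i j => ?_
  simp only [Matrix.smul_apply, smul_eq_mul]
  rw [hc i j, Finset.mul_sum]
  simp only [mul_assoc]

theorem FiniteRank.neg {b : Matrix Λ Λ F} (h : FiniteRank b) : FiniteRank (-b) := by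
  simpa using h.smul (-1)

theorem FiniteRank.add {a b : Matrix Λ Λ F} (ha : FiniteRank a) (hb : FiniteRank b) :
    FiniteRank (a + b) := by
  unfold FiniteRank at ha hb
  refine Submodule.finiteDimensional_of_le
    (S₂ := Submodule.span F (Set.range fun i j => a i j) ⊔
      Submodule.span F (Set.range fun i j => b i j)) (Submodule.span_le.2 ?_)
  rintro _ ⟨i, rfl⟩
  exact Submodule.add_mem_sup (Submodule.subset_span ⟨i, rfl⟩) (Submodule.subset_span ⟨i, rfl⟩)

/-- From b = c b over `I` follows ba = c(ba) over `I`; the support hypothesis permits the exchange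
of sums. -/
theorem FiniteRank.mulMat_right {b a : Matrix Λ Λ F} (h : FiniteRank b)
    (hs : ∀ i j, (Function.support fun k => b i k * a k j).Finite) : FiniteRank (mulMat b a) := by
  obtain ⟨I, c, hc⟩ := h.exists_factor
  refine finiteRank_of_factor (c := c) (m := mulMat b a) (I := I) fun i j => ?_
  simp only [mulMat, mul_finsum]
  rw [← finsum_sum_comm]
  · refine finsum_congr fun l => ?_
    rw [hc i l, Finset.sum_mul]
    simp only [mul_assoc]
  · exact fun k _ => (hs k j).subset fun l hl => right_ne_zero_of_mul hl

theorem transpose_mulMat (a b : Matrix Λ Λ F) :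
    (mulMat a b).transpose = mulMat b.transpose a.transpose := by
  ext i j
  exact finsum_congr fun k => mul_comm _ _

theorem FiniteRank.mulMat_left {a b : Matrix Λ Λ F} (h : FiniteRank b)
    (hs : ∀ i j, (Function.support fun k => a i k * b k j).Finite) : FiniteRank (mulMat a b) := by
  rw [← Matrix.transpose_transpose (mulMat a b), transpose_mulMat]
  refine (h.transpose.mulMat_right fun i j => ?_).transpose
  simpa only [Matrix.transpose_apply, mul_comm] using hs j i

theorem not_finiteRank_of_identity_minor {b : Matrix Λ Λ F} {r s : ℕ → Λ}
    (h : ∀ m n, b (r m) (s n) = if m = n then 1 else 0) : ¬ FiniteRank b := by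
  intro hb
  unfold FiniteRank at hb
  have hli : LinearIndependent F fun n j => b (r n) j := by
    -- Restricted to the columns `s n`, the rows `r n` become the standard unit vectors.
    refine LinearIndependent.of_comp (LinearMap.funLeft F F s) ?_
    convert Pi.linearIndependent_single_one ℕ F using 1
    ext m n
    simp [LinearMap.funLeft_apply, h, Pi.single_apply, eq_comm]
  let v : ℕ → Submodule.span F (Set.range fun i j => b i j) :=
    fun n => ⟨fun j => b (r n) j, Submodule.subset_span ⟨r n, rfl⟩⟩
  have hv : LinearIndependent F v :=
    LinearIndependent.of_comp (Submodule.subtype _) hli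
  exact not_finite_iff_infinite.2 inferInstance hv.finite

end FiniteRank

/-! ### Finite rank on `L(F)` and the normal subgroup -/

section Products

open scoped Classical

variable {Λ F : Type*} [Field F] [Preorder Λ]

theorem almostUpper_one : AlmostUpper (1 : Matrix Λ Λ F) :=
  (adapted_one ∅).almostUpper

theorem AlmostUpper.sub {a b : Matrix Λ Λ F} (ha : AlmostUpper a) (hb : AlmostUpper b) :
    AlmostUpper (a - b) := by
  refine (Set.Finite.union ha hb).subset ?_
  rintro p ⟨h1, h2⟩
  by_cases h : a p.1 p.2 = 0
  · exact Or.inr ⟨h1, fun h' => h2 (by simp [h, h'])⟩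
  · exact Or.inl ⟨h1, h⟩

variable [ZLike Λ]

theorem AlmostUpper.mul_support_finite {a b : Matrix Λ Λ F} (ha : AlmostUpper a)
    (hb : AlmostUpper b) (i j : Λ) : (Function.support fun k => a i k * b k j).Finite := by
  obtain ⟨S, hS₀, hS, h1, h2⟩ := exists_adapted₂ {i, j} ha hb
  refine S.finite_toSet.subset fun k hk => ?_
  exact mem_of_between hS.ordConnected le_rfl (hS₀ (by simp)) (hS₀ (by simp))
    (h1 i k (left_ne_zero_of_mul hk)) (h2 k j (right_ne_zero_of_mul hk))

theorem mulMat_add {a b c : Matrix Λ Λ F} (ha : AlmostUpper a) (hb : AlmostUpper b)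
    (hc : AlmostUpper c) : mulMat a (b + c) = mulMat a b + mulMat a c := by
  ext i j
  simp only [mulMat, Matrix.add_apply, mul_add]
  exact finsum_add_distrib (ha.mul_support_finite hb i j) (ha.mul_support_finite hc i j)

theorem add_mulMat {a b c : Matrix Λ Λ F} (ha : AlmostUpper a) (hb : AlmostUpper b)
    (hc : AlmostUpper c) : mulMat (a + b) c = mulMat a c + mulMat b c := by
  ext i j
  simp only [mulMat, Matrix.add_apply, add_mul]
  exact finsum_add_distrib (ha.mul_support_finite hc i j) (hb.mul_support_finite hc i j)

theorem FiniteRank.left_mul {a b : Matrix Λ Λ F} (h : FiniteRank b) (ha : AlmostUpper a)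
    (hb : AlmostUpper b) : FiniteRank (mulMat a b) :=
  h.mulMat_left (ha.mul_support_finite hb)

theorem FiniteRank.right_mul {a b : Matrix Λ Λ F} (h : FiniteRank b) (ha : AlmostUpper a)
    (hb : AlmostUpper b) : FiniteRank (mulMat b a) :=
  h.mulMat_right (hb.mul_support_finite ha)

/-- Let `S` contain `i` and a point `k` from which `x` vanishes. A nonzero entry in row `i` at `j`
outside `S` forces `j` above `S`, hence above `k`, where `x` is zero. -/
theorem AlmostUpper.act_support_finite {b : Matrix Λ Λ F} (hb : AlmostUpper b) {x : Λ → F}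
    (hx : x ∈ vecL Λ F) (i : Λ) : (Function.support fun j => b i j * x j).Finite := by
  obtain ⟨k, hk⟩ := hx
  obtain ⟨S, hS₀, hS, h1⟩ := exists_adapted {i, k} hb
  refine S.finite_toSet.subset fun j hj => ?_
  by_contra hjS
  rcases h1 i j (left_ne_zero_of_mul hj) with hij | h
  · rcases hS j hjS with h | h
    · exact (h i (hS₀ (by simp))).not_ge hij
    · exact right_ne_zero_of_mul hj (hk j (h k (hS₀ (by simp))).le)
  · exact hjS h.2

/-- Only finitely many elements lie above all of `Λ`. -/
theorem finite_setOf_isTop : {j : Λ | ∀ k, k ≤ j}.Finite := by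
  by_cases h : ∃ j : Λ, ∀ k, k ≤ j
  · obtain ⟨j, hj⟩ := h
    obtain ⟨S, hS₀, hS⟩ := ZLike.exists_finite_stronglyConvex {j}
    -- Two top elements are equivalent, so neither is strictly comparable to the other.
    refine S.finite_toSet.subset fun k hk => ?_
    by_contra hkS
    rcases hS k hkS with h | h
    · exact (h j (hS₀ (by simp))).not_ge (hk j)
    · exact (h j (hS₀ (by simp))).not_ge (hj k)
  · convert Set.finite_empty
    exact Set.eq_empty_of_forall_notMem fun j hj => h ⟨j, hj⟩

/-- Column `j` is the image of the unit vector at `j`, which lies in `L(F)` unless `j` is a top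
element; the finitely many top columns do not affect finiteness. Conversely, a factorization of `b`
over `I` puts every image in the span of the columns of `c` in `I`. -/
theorem hasFiniteRank_iff {b : Matrix Λ Λ F} (hb : AlmostUpper b) :
    HasFiniteRank b ↔ FiniteRank b := by
  constructor
  · intro h
    unfold HasFiniteRank at h
    have hfin : FiniteDimensional F
        (Submodule.span F ((fun j i => b i j) '' {j : Λ | ∀ k, k ≤ j})) :=
      FiniteDimensional.span_of_finite F (finite_setOf_isTop.image _)
    have hT : FiniteRank b.transpose := by
      refine Submodule.finiteDimensional_of_le
        (S₂ := Submodule.span F (act b '' vecL Λ F) ⊔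
          Submodule.span F ((fun j i => b i j) '' {j : Λ | ∀ k, k ≤ j})) (Submodule.span_le.2 ?_)
      rintro _ ⟨j, rfl⟩
      by_cases hj : ∀ k, k ≤ j
      · exact Submodule.mem_sup_right (Submodule.subset_span ⟨j, hj, rfl⟩)
      · push Not at hj
        obtain ⟨k, hk⟩ := hj
        refine Submodule.mem_sup_left (Submodule.subset_span ⟨Pi.single j 1, ⟨k, ?_⟩, ?_⟩)
        · exact fun l hl => Pi.single_eq_of_ne (fun h => hk (hl.trans h.le)) 1
        · ext i
          change ∑ᶠ l, b i l * (Pi.single j 1 : Λ → F) l = b i j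
          rw [finsum_eq_single _ j fun l hl => by rw [Pi.single_eq_of_ne hl, mul_zero]]
          simp
    simpa using hT.transpose
  · intro h
    obtain ⟨I, c, hc⟩ := h.exists_factor
    have hfin : FiniteDimensional F (Submodule.span F ((fun k i => c i k) '' (I : Set Λ))) :=
      FiniteDimensional.span_of_finite F (I.finite_toSet.image _)
    refine Submodule.finiteDimensional_of_le
      (S₂ := Submodule.span F ((fun k i => c i k) '' (I : Set Λ))) (Submodule.span_le.2 ?_)
    rintro _ ⟨x, hx, rfl⟩
    -- The coefficients are the coordinates of b x at the indices in `I`.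
    have hact : act b x = ∑ k ∈ I, act b x k • fun i => c i k := by
      ext i
      simp only [Finset.sum_apply, Pi.smul_apply, smul_eq_mul, mul_comm _ (c i _)]
      simp only [act, mul_finsum]
      rw [← finsum_sum_comm]
      · refine finsum_congr fun l => ?_
        rw [hc i l, Finset.sum_mul]
        simp only [mul_assoc]
      · exact fun k _ => (hb.act_support_finite hx k).subset fun l hl => right_ne_zero_of_mul hl
    rw [hact]
    exact Submodule.sum_mem _ fun k hk =>
      Submodule.smul_mem _ _ (Submodule.subset_span ⟨k, hk, rfl⟩)

theorem mem_finiteRankAU {g : AU Λ F} : g ∈ finiteRankAU Λ F ↔ FiniteRank (g.toMatrix - 1) := by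
  rw [← hasFiniteRank_iff (g.almostUpper.sub almostUpper_one)]
  constructor
  · rintro ⟨b, hb, h⟩
    rwa [hb, add_sub_cancel_left]
  · exact fun h => ⟨_, (add_sub_cancel _ _).symm, h⟩

theorem mulMat_sub {a b c : Matrix Λ Λ F} (ha : AlmostUpper a) (hb : AlmostUpper b)
    (hc : AlmostUpper c) : mulMat a (b - c) = mulMat a b - mulMat a c := by
  rw [eq_sub_iff_add_eq, ← mulMat_add ha (hb.sub hc) hc, sub_add_cancel]

theorem sub_mulMat {a b c : Matrix Λ Λ F} (ha : AlmostUpper a) (hb : AlmostUpper b)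
    (hc : AlmostUpper c) : mulMat (a - b) c = mulMat a c - mulMat b c := by
  rw [eq_sub_iff_add_eq, ← add_mulMat (ha.sub hb) hb hc, sub_add_cancel]

theorem AU.mulMat_inv (g : AU Λ F) : mulMat g.toMatrix g⁻¹.toMatrix = 1 := by
  rw [← AU.toMatrix_mul, mul_inv_cancel, AU.toMatrix_one]

theorem AU.inv_mulMat (g : AU Λ F) : mulMat g⁻¹.toMatrix g.toMatrix = 1 := by
  rw [← AU.toMatrix_mul, inv_mul_cancel, AU.toMatrix_one]

variable (Λ F) in
/-- The subgroup of finite-rank perturbations of the identity. -/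
noncomputable def finiteRankSubgroup : Subgroup (AU Λ F) where
  carrier := finiteRankAU Λ F
  one_mem' := by
    rw [mem_finiteRankAU, AU.toMatrix_one, sub_self]
    exact finiteRank_zero
  mul_mem' := fun {g h} hg hh => by
    rw [mem_finiteRankAU] at *
    have e : (g * h).toMatrix - 1 =
        mulMat g.toMatrix (h.toMatrix - 1) + (g.toMatrix - 1) := by
      rw [mulMat_sub g.almostUpper h.almostUpper almostUpper_one, mulMat_one, AU.toMatrix_mul]
      abel
    rw [e]
    exact (hh.left_mul g.almostUpper (h.almostUpper.sub almostUpper_one)).add hg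
  inv_mem' := fun {g} hg => by
    rw [mem_finiteRankAU] at *
    have e : g⁻¹.toMatrix - 1 = -mulMat g⁻¹.toMatrix (g.toMatrix - 1) := by
      rw [mulMat_sub g⁻¹.almostUpper g.almostUpper almostUpper_one, mulMat_one, AU.inv_mulMat]
      abel
    rw [e]
    exact (hg.left_mul g⁻¹.almostUpper (g.almostUpper.sub almostUpper_one)).neg

instance : (finiteRankSubgroup Λ F).Normal := by
  refine ⟨fun n hn g => ?_⟩
  change n ∈ finiteRankAU Λ F at hn
  change g * n * g⁻¹ ∈ finiteRankAU Λ F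
  rw [mem_finiteRankAU] at *
  have hb := n.almostUpper.sub almostUpper_one
  have e : (g * n * g⁻¹).toMatrix - 1 =
      mulMat (mulMat g.toMatrix (n.toMatrix - 1)) g⁻¹.toMatrix := by
    rw [mulMat_sub g.almostUpper n.almostUpper almostUpper_one, mulMat_one,
      sub_mulMat (g.almostUpper.mul n.almostUpper) g.almostUpper g⁻¹.almostUpper, AU.mulMat_inv]
    rfl
  rw [e]
  exact (hn.left_mul g.almostUpper hb).right_mul g⁻¹.almostUpper (g.almostUpper.mul hb)

end Products

/-! ### Truncation to finite blocks and density -/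

section Truncation

open scoped Classical

variable {Λ F : Type*} [Field F]

/-- The infinite matrix that agrees with `M` on `T × T` and with the identity elsewhere. -/
noncomputable def extendByOne (T : Finset Λ) (M : Matrix T T F) : Matrix Λ Λ F :=
  fun i j => if h : i ∈ T ∧ j ∈ T then M ⟨i, h.1⟩ ⟨j, h.2⟩ else (1 : Matrix Λ Λ F) i j

theorem extendByOne_of_mem {T : Finset Λ} (M : Matrix T T F) {i j : Λ} (hi : i ∈ T) (hj : j ∈ T) :
    extendByOne T M i j = M ⟨i, hi⟩ ⟨j, hj⟩ :=
  dif_pos ⟨hi, hj⟩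

theorem extendByOne_of_not_mem {T : Finset Λ} (M : Matrix T T F) {i j : Λ}
    (h : ¬ (i ∈ T ∧ j ∈ T)) : extendByOne T M i j = (1 : Matrix Λ Λ F) i j :=
  dif_neg h

theorem extendByOne_one (T : Finset Λ) : extendByOne T (1 : Matrix T T F) = 1 := by
  ext i j
  by_cases h : i ∈ T ∧ j ∈ T
  · rw [extendByOne_of_mem _ h.1 h.2]
    simp [Matrix.one_apply]
  · exact extendByOne_of_not_mem _ h

theorem mulMat_extendByOne (T : Finset Λ) (M N : Matrix T T F) :
    mulMat (extendByOne T M) (extendByOne T N) = extendByOne T (M * N) := by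
  ext i j
  by_cases hi : i ∈ T
  · have hsum : mulMat (extendByOne T M) (extendByOne T N) i j =
        ∑ k : T, M ⟨i, hi⟩ k * extendByOne T N k j := by
      refine (finsum_eq_sum_of_support_subset (s := T) _ fun k hk => ?_).trans ?_
      · by_contra hkT
        refine left_ne_zero_of_mul hk ?_
        rw [extendByOne_of_not_mem _ fun h => hkT h.2]
        exact Matrix.one_apply_ne fun h => hkT (by simpa [h] using hi)
      · rw [← Finset.sum_coe_sort]
        exact Finset.sum_congr rfl fun k _ => by rw [extendByOne_of_mem _ hi k.2]
    rw [hsum]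
    by_cases hj : j ∈ T
    · rw [extendByOne_of_mem _ hi hj, Matrix.mul_apply]
      exact Finset.sum_congr rfl fun k _ => by rw [extendByOne_of_mem _ k.2 hj]
    · rw [extendByOne_of_not_mem _ fun h => hj h.2,
        Matrix.one_apply_ne fun h => hj (by rwa [← h])]
      refine Finset.sum_eq_zero fun k _ => ?_
      rw [extendByOne_of_not_mem _ fun h => hj h.2,
        Matrix.one_apply_ne fun h => hj (by rw [← h]; exact k.2), mul_zero]
  · rw [extendByOne_of_not_mem _ fun h => hi h.1]
    refine (finsum_eq_single _ i fun k hk => ?_).trans ?_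
    · rw [extendByOne_of_not_mem _ fun h => hi h.1, Matrix.one_apply_ne hk.symm, zero_mul]
    · rw [extendByOne_of_not_mem _ fun h => hi h.1, extendByOne_of_not_mem _ fun h => hi h.1,
        Matrix.one_apply_eq, one_mul]

theorem finiteRank_extendByOne_sub_one (T : Finset Λ) (M : Matrix T T F) :
    FiniteRank (extendByOne T M - 1) := by
  refine finiteRank_of_row_support (T := T) fun i j hij => ?_
  by_contra hi
  exact hij (by rw [Matrix.sub_apply, extendByOne_of_not_mem _ fun h => hi h.1, sub_self])

variable [Preorder Λ]

theorem adapted_extendByOne (T : Finset Λ) (M : Matrix T T F) : Adapted T (extendByOne T M) := by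
  intro i j hij
  by_cases h : i ∈ T ∧ j ∈ T
  · exact Or.inr h
  · rw [extendByOne_of_not_mem _ h] at hij
    exact adapted_one T i j hij

/-- Extension by the identity is multiplicative, so the extension of `M⁻¹` inverts that of `M`, also
on every larger convex block. -/
theorem nonsingular_extendByOne {T : Finset Λ} (hT : (T : Set Λ).OrdConnected) {M : Matrix T T F}
    (hM : IsUnit M) : Nonsingular (extendByOne T M) := by
  refine ⟨T, hT, fun U hU hTU => ?_⟩
  have hmul : res U (extendByOne T M) * res U (extendByOne T M⁻¹) = 1 := by
    rw [← res_mulMat (adapted_extendByOne T M) (adapted_extendByOne T M⁻¹) hU hTU,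
      mulMat_extendByOne, Matrix.mul_nonsing_inv _ ((Matrix.isUnit_iff_isUnit_det _).1 hM),
      extendByOne_one, res_one]
  exact IsUnit.of_mul_eq_one _ hmul

/-- A basic neighbourhood in the product topology restricts only finitely many coordinates. -/
theorem exists_open_entries {U : Set (AU Λ F)} (hU : IsOpen U) {g : AU Λ F} (hg : g ∈ U)
    {S : Finset Λ} (hS : (S : Set Λ).OrdConnected) (hgS : g ∈ UJoin Λ F S) :
    ∃ E : Finset (Λ × Λ), ∀ h ∈ UJoin Λ F S,
      (∀ p ∈ E, h.toMatrix p.1 p.2 = g.toMatrix p.1 p.2) → h ∈ U := by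
  have h1 := isOpen_coinduced.1 (isOpen_iSup_iff.1 hU ⟨S, hS⟩)
  obtain ⟨V, hV, hVU⟩ := (@isOpen_induced_iff _ _ (@Pi.topologicalSpace (Λ × Λ) (fun _ => F) fun _ => ⊥)
    _ _).1 h1
  have hgV : (fun p : Λ × Λ => g.toMatrix p.1 p.2) ∈ V := by
    have : (⟨g, hgS⟩ : UJoin Λ F S) ∈ Subtype.val ⁻¹' U := hg
    rwa [← hVU] at this
  obtain ⟨E, u, hu, hEV⟩ := (@isOpen_pi_iff (Λ × Λ) (fun _ => F) (fun _ => ⊥) V).1 hV _ hgV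
  refine ⟨E, fun h hh hE => ?_⟩
  have hhV : (fun p : Λ × Λ => h.toMatrix p.1 p.2) ∈ V :=
    hEV fun p hp => by
      simpa only [hE p hp] using (hu p hp).2
  have : (⟨h, hh⟩ : UJoin Λ F S) ∈ Subtype.val ⁻¹' U := by
    rw [← hVU]
    exact hhV
  exact this

variable [ZLike Λ]

theorem dense_finiteRankSubgroup : Dense (finiteRankSubgroup Λ F : Set (AU Λ F)) := by
  rw [dense_iff_inter_open]
  rintro U hU ⟨g, hg⟩
  obtain ⟨A, -, hA⟩ := g.nonsingular
  obtain ⟨S, hAS, hS, hgS⟩ := exists_adapted A g.almostUpper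
  have hgJ : g ∈ UJoin Λ F S := fun i j hij => by
    by_contra h
    exact hij (Relation.ReflTransGen.single (hgS i j h))
  obtain ⟨E, hE⟩ := exists_open_entries hU hg hS.ordConnected hgJ
  -- `T` must cover the prescribed entries and contain `S`, so that the block of `g` on `T` is
  -- invertible. The truncation still lies in `UJoin Λ F S`, with the original `S`.
  obtain ⟨T, hT₀, hT⟩ := ZLike.exists_finite_stronglyConvex
    (S ∪ (E.image Prod.fst ∪ E.image Prod.snd))
  have hST := Finset.union_subset_left hT₀
  have hET := Finset.union_subset_right hT₀
  let h : AU Λ F := ⟨extendByOne T (res T g.toMatrix),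
    (adapted_extendByOne T _).almostUpper,
    nonsingular_extendByOne hT.ordConnected (hA T hT.ordConnected (hAS.trans hST))⟩
  refine ⟨h, hE h (fun i j hij => ?_) fun p hp => ?_,
    mem_finiteRankAU.2 (finiteRank_extendByOne_sub_one T _)⟩
  · change extendByOne T (res T g.toMatrix) i j = 0
    by_cases hm : i ∈ T ∧ j ∈ T
    · rw [extendByOne_of_mem _ hm.1 hm.2]
      exact hgJ i j hij
    · rw [extendByOne_of_not_mem _ hm]
      refine Matrix.one_apply_ne fun h => hij ?_
      rw [h]
      exact Relation.ReflTransGen.refl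
  · exact extendByOne_of_mem _
      (Finset.union_subset_left hET (Finset.mem_image_of_mem _ hp))
      (Finset.union_subset_right hET (Finset.mem_image_of_mem _ hp))

end Truncation

/-! ### Elements outside the subgroup modulo scalars -/

section InfiniteRank

open scoped Classical

variable {Λ F : Type*} [Field F] [Preorder Λ]

/-- Adding to the identity a strictly upper triangular matrix with square zero. -/
noncomputable def oneAdd {b : Matrix Λ Λ F} (hb : ∀ i j, b i j ≠ 0 → i ≤ j)
    (hsq : ∀ i j k, b i j = 0 ∨ b j k = 0) : AU Λ F where
  toMatrix := 1 + b
  almostUpper := by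
    refine Adapted.almostUpper (S := ∅) fun i j hij => ?_
    by_cases h : b i j = 0
    · rw [Matrix.add_apply, h, add_zero] at hij
      exact adapted_one ∅ i j hij
    · exact Or.inl (hb i j h)
  nonsingular := by
    refine ⟨∅, by simpa using Set.ordConnected_empty, fun T _ _ => ?_⟩
    have e : res T (1 + b) = 1 + res T b := by
      rw [← res_one T]
      rfl
    -- `hsq` kills each term of b² separately, so the square is zero on every finite block.
    have hz : res T b * res T b = 0 := by
      ext i k
      rw [Matrix.mul_apply]
      exact Finset.sum_eq_zero fun j _ => mul_eq_zero.2 (hsq i j k)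
    refine IsUnit.of_mul_eq_one (1 - res T b) ?_
    rw [e, add_mul, mul_sub, mul_sub, hz]
    simp

variable [ZLike Λ] [Infinite Λ]

/-- A point outside a finite strongly convex set containing `i` is strictly comparable to `i`. -/
theorem exists_lt_notMem (A : Finset Λ) : ∃ i j : Λ, i < j ∧ i ∉ A ∧ j ∉ A := by
  obtain ⟨i, hi⟩ := A.exists_notMem
  obtain ⟨S, hAS, hS⟩ := ZLike.exists_finite_stronglyConvex (insert i A)
  obtain ⟨j, hj⟩ := S.exists_notMem
  have hjA : j ∉ A := fun h => hj (hAS (Finset.mem_insert_of_mem h))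
  have hiS : i ∈ S := hAS (Finset.mem_insert_self i A)
  rcases hS j hj with h | h
  · exact ⟨j, i, h i hiS, hjA, hi⟩
  · exact ⟨i, j, h i hiS, hi, hjA⟩

variable (Λ) in
/-- There are infinitely many disjoint pairs `r n < s n`. -/
theorem exists_disjoint_pairs : ∃ r s : ℕ → Λ, (∀ n, r n ≤ s n) ∧ (∀ m n, r m ≠ s n) ∧
    Function.Injective r ∧ Function.Injective s := by
  have : Std.Symm fun p q : Λ × Λ =>
      p.1 ≠ q.1 ∧ p.1 ≠ q.2 ∧ p.2 ≠ q.1 ∧ p.2 ≠ q.2 :=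
    ⟨fun p q h => ⟨h.1.symm, h.2.2.1.symm, h.2.1.symm, h.2.2.2.symm⟩⟩
  -- Greedy choice: each new pair avoids both coordinates of all earlier ones.
  obtain ⟨f, hf, hd⟩ := exists_seq_of_forall_finset_exists' (fun p : Λ × Λ => p.1 < p.2)
    (fun p q => p.1 ≠ q.1 ∧ p.1 ≠ q.2 ∧ p.2 ≠ q.1 ∧ p.2 ≠ q.2) fun A _ => by
      obtain ⟨i, j, hij, hi, hj⟩ := exists_lt_notMem (A.image Prod.fst ∪ A.image Prod.snd)
      refine ⟨(i, j), hij, fun p hp => ?_⟩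
      have h1 := Finset.mem_union_left (A.image Prod.snd) (Finset.mem_image_of_mem Prod.fst hp)
      have h2 := Finset.mem_union_right (A.image Prod.fst) (Finset.mem_image_of_mem Prod.snd hp)
      exact ⟨fun h => hi (h.subst h1), fun h => hj (h.subst h1), fun h => hi (h.subst h2),
        fun h => hj (h.subst h2)⟩
  refine ⟨fun n => (f n).1, fun n => (f n).2, fun n => (hf n).le, fun m n => ?_, fun m n h => ?_,
    fun m n h => ?_⟩
  · by_cases hmn : m = n
    · rw [hmn]
      exact (hf n).ne
    · exact (hd hmn).2.1
  · by_contra hmn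
    exact (hd hmn).1 h
  · by_contra hmn
    exact (hd hmn).2.2.2 h

variable (Λ F) in
/-- An element of `AU Λ F` with an infinite identity minor off the diagonal. -/
theorem exists_identity_minor : ∃ (g : AU Λ F) (r s : ℕ → Λ), (∀ m n, r m ≠ s n) ∧
    ∀ m n, g.toMatrix (r m) (s n) = if m = n then 1 else 0 := by
  obtain ⟨r, s, hle, hrs, hr, hs⟩ := exists_disjoint_pairs Λ
  let b : Matrix Λ Λ F := fun i j => if ∃ n, i = r n ∧ j = s n then 1 else 0
  have hb : ∀ i j, b i j ≠ 0 → ∃ n, i = r n ∧ j = s n := fun i j h => by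
    by_contra h'
    exact h (if_neg h')
  -- b² = 0 because no `s n` is an `r m`; injectivity of `r` and `s` makes the minor exactly the
  -- identity.
  refine ⟨oneAdd (b := b) (fun i j h => ?_) fun i j k => ?_, r, s, hrs, fun m n => ?_⟩
  · obtain ⟨n, rfl, rfl⟩ := hb i j h
    exact hle n
  · by_contra! h
    obtain ⟨m, -, rfl⟩ := hb i j h.1
    obtain ⟨n, h', -⟩ := hb _ k h.2
    exact hrs n m h'.symm
  · change (1 : Matrix Λ Λ F) (r m) (s n) + b (r m) (s n) = _
    rw [Matrix.one_apply_ne (hrs m n), zero_add]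
    refine if_congr ⟨?_, ?_⟩ rfl rfl
    · rintro ⟨k, h1, h2⟩
      exact (hr h1).trans (hs h2).symm
    · rintro rfl
      exact ⟨m, rfl, rfl⟩

-- With z = ζ·1, the matrices nz and ζ(n - 1) agree off the diagonal, and the latter has finite
-- rank. The case z = 1 gives properness of the subgroup; general z gives properness of its image in
-- the quotient.
variable (Λ F) in
theorem exists_ne_finiteRank_mul_scalar :
    ∃ g : AU Λ F, ∀ n ∈ finiteRankSubgroup Λ F, ∀ z ∈ scalarSubgroup Λ F, g ≠ n * z := by
  obtain ⟨g, r, s, hrs, hg⟩ := exists_identity_minor Λ F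
  refine ⟨g, fun n hn z hz hgz => ?_⟩
  have hn' : FiniteRank (n.toMatrix - 1) := mem_finiteRankAU.1 hn
  have hz' : IsScalar z.toMatrix := hz
  refine not_finiteRank_of_identity_minor (r := r) (s := s) (fun k l => ?_)
    -- The scalar ζ is read off at an arbitrary diagonal position.
    (hn'.smul (z.toMatrix (s 0) (s 0)))
  rw [← hg, hgz, AU.toMatrix_mul, hz'.mulMat_apply_right, hz'.2 (s l) (s 0), Matrix.smul_apply,
    Matrix.sub_apply, Matrix.one_apply_ne (hrs k l), sub_zero, smul_eq_mul, mul_comm]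

-- The witness is the elementary matrix 1 + E_ij with `i < j`.
variable (Λ F) in
theorem exists_finiteRank_not_scalar : ∃ g ∈ finiteRankSubgroup Λ F, g ∉ scalarSubgroup Λ F := by
  obtain ⟨i, j, hij, -, -⟩ := exists_lt_notMem (∅ : Finset Λ)
  have hne : i ≠ j := hij.ne
  have hb : ∀ k l, Matrix.single i j (1 : F) k l ≠ 0 → i = k ∧ j = l := fun k l h => by
    by_contra h'
    exact h (Matrix.single_apply_of_ne _ _ _ _ _ h')
  let g : AU Λ F := oneAdd (b := Matrix.single i j 1)
    (fun k l h => by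
      obtain ⟨rfl, rfl⟩ := hb k l h
      exact hij.le)
    fun k l m => by
      by_contra! h
      exact hne ((hb l m h.2).1.trans (hb k l h.1).2.symm)
  refine ⟨g, mem_finiteRankAU.2 ?_, fun h => ?_⟩
  · change FiniteRank (1 + Matrix.single i j 1 - 1)
    rw [add_sub_cancel_left]
    exact finiteRank_of_row_support (T := {i}) fun k l h => by simp [(hb k l h).1]
  · have h0 : (1 : Matrix Λ Λ F) i j + Matrix.single i j (1 : F) i j = 0 := h.1 i j hne
    rw [Matrix.one_apply_ne hne, zero_add, Matrix.single_apply_same] at h0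
    exact one_ne_zero h0

end InfiniteRank

end AlmostUpperTriangular

/-! ### Passage to the quotient by the scalars -/

open AlmostUpperTriangular in
theorem mainTheorem5 (Λ : Type*) [Preorder Λ] [AlmostUpperTriangular.ZLike Λ] [Infinite Λ]
    (F : Type*) [Field F] :
    (∃ N : Subgroup (AlmostUpperTriangular.AU Λ F),
      (N : Set (AlmostUpperTriangular.AU Λ F)) = AlmostUpperTriangular.finiteRankAU Λ F ∧
      N ≠ ⊤ ∧ Dense (N : Set (AlmostUpperTriangular.AU Λ F)) ∧ N.Normal) ∧
    Nontrivial (AlmostUpperTriangular.AU Λ F ⧸ AlmostUpperTriangular.scalarSubgroup Λ F) ∧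
    ¬ IsSimpleGroup
      (AlmostUpperTriangular.AU Λ F ⧸ AlmostUpperTriangular.scalarSubgroup Λ F) := by
  obtain ⟨g, hg⟩ := exists_ne_finiteRank_mul_scalar Λ F
  obtain ⟨e, heN, heZ⟩ := exists_finiteRank_not_scalar Λ F
  refine ⟨⟨finiteRankSubgroup Λ F, rfl, fun h => ?_, dense_finiteRankSubgroup, inferInstance⟩,
    ⟨e, 1, fun h => heZ ((QuotientGroup.eq_one_iff e).1 h)⟩, fun hsimple => ?_⟩
  · exact hg g (h ▸ Subgroup.mem_top g) 1 (Subgroup.one_mem _) (mul_one g).symm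
  · have hnormal := Subgroup.Normal.map (H := finiteRankSubgroup Λ F) inferInstance
      (QuotientGroup.mk' (scalarSubgroup Λ F)) (QuotientGroup.mk'_surjective _)
    have hmem : (e : AU Λ F ⧸ scalarSubgroup Λ F) ∈
        (finiteRankSubgroup Λ F).map (QuotientGroup.mk' (scalarSubgroup Λ F)) := ⟨e, heN, rfl⟩
    rcases hsimple.eq_bot_or_eq_top_of_normal _ hnormal with h | h
    · rw [h] at hmem
      exact heZ ((QuotientGroup.eq_one_iff e).1 hmem)
    · have hgm : (g : AU Λ F ⧸ scalarSubgroup Λ F) ∈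
          (finiteRankSubgroup Λ F).map (QuotientGroup.mk' (scalarSubgroup Λ F)) := by
        rw [h]
        exact Subgroup.mem_top _
      obtain ⟨n, hn, hng⟩ := hgm
      -- Equal classes of `n` and `g` make n⁻¹g scalar, so g = n(n⁻¹g) is of the excluded form.
      exact hg n hn (n⁻¹ * g) (QuotientGroup.eq.1 hng) (mul_inv_cancel_left n g).symm
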